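/- Let $\mathfrak H^1=\mathbb Q\langle z_k\mid k\ge 1\rangle$ be the free (noncommutative) $\mathbb Q$-algebra on variables $z_1,z_2,z_3,\dots$. The harmonic product $*$ is the $\mathbb Q$-bilinear product on $\mathfrak H^1$ determined by $w*1=1*w=w$ and $$z_kw*z_lw'=z_k(w*z_lw')+z_l(z_kw*w')+z_{k+l}(w*w')\qquad(k,l\ge 1,\ w,w'\in\mathfrak H^1),$$ and the star-transformation $S$ is the $\mathbb Q$-linear map $\mathfrak H^1\to\mathfrak H^1$ determined by $$S(1)=1,\qquad S(z_k)=z_k,\qquad S(z_kz_lw)=z_kS(z_lw)+S(z_{k+l}w)\qquad(k,l\ge1,\ w \text{ a word}).$$ Let $a,b,c$ be positive integers with $a+b=2c$. For integers $p,q\ge 0$ let $I_{p,q}$ be the family of all shuffles of the sequences $(\{a,b\}^p)=(a,b,\dots,a,b)$ (of length $2p$) and $(\{c\}^q)=(c,\dots,c)$ (of length $q$), and let $J_{p,q}$ be the family of all shuffles of $(b,\{a,b\}^p)$ and $(\{c\}^q)$. Shuffles are counted with multiplicity, i.e. there is one for each choice of the positions occupied by the entries of the first sequence; for $a\ne b$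 all these multiplicities are $1$. Put $$\mathfrak s_{p,q}=\sum_{(k_1,\dots,k_{2p+q})\in I_{p,q}}z_{k_1}\cdots z_{k_{2p+q}},\qquad \mathfrak t_{p,q}=\sum_{(k_1,\dots,k_{2p+q+1})\in J_{p,q}}z_{k_1}\cdots z_{k_{2p+q+1}}.$$ Then for all integers $p,q\ge 0$ the following identities hold in $\mathfrak H^1$: $$S(\mathfrak s_{p,q})=\sum_{\substack{2i+k+u=2p\\ j+l+v=q}}(-1)^{j+k}\binom{k+l}{k}\binom{u+v}{u}\,\mathfrak s_{i,j}*S(z_c^{k+l})*S(z_c^{u+v}),$$ $$S(\mathfrak t_{p,q})=\sum_{\substack{2i+k+u=2p\\ j+l+v=q}}(-1)^{j+k}\binom{k+l}{k}\binom{u+v}{u}\,\mathfrak t_{i,j}*S(z_c^{k+l})*S(z_c^{u+v}),$$ where the sums run over all non-negative integers $i,k,u,j,l,v$ satisfying the indicated conditions, $z_c^n$ is the concatenation power in $\mathfrak H^1$, and the products $*$ are taken from left to right. -/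

import Mathlib

open Finset

namespace HarmonicAlgebra

/-- The free (noncommutative) `ℚ`-algebra on the variables `z_k`, `k = 1, 2, 3, …`.
Its ring multiplication is concatenation of words. -/
abbrev H1 : Type := FreeAlgebra ℚ ℕ+

/-- The variable `z_k`. -/
noncomputable def z (k : ℕ+) : H1 := FreeAlgebra.ι ℚ k

/-- The word `z_{k₁} ⋯ z_{kₙ}` attached to the index `(k₁, …, kₙ)`; the empty index gives `1`. -/
noncomputable def word (w : List ℕ+) : H1 := (w.map z).prod

/-- The words form a `ℚ`-basis of `H1` (see `basis_apply`). -/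
noncomputable def basis : Module.Basis (FreeMonoid ℕ+) ℚ H1 := FreeAlgebra.basisFreeMonoid ℚ ℕ+

theorem basis_apply (w : List ℕ+) : basis (FreeMonoid.ofList w) = word w := by
  simp [basis, word, FreeAlgebra.basisFreeMonoid, FreeAlgebra.equivMonoidAlgebraFreeMonoid,
    FreeMonoid.lift_apply]
  rfl

/-- The harmonic product of two words. -/
noncomputable def harmonicWord : List ℕ+ → List ℕ+ → H1
  | [], v => word v
  | k :: u, [] => word (k :: u)
  | k :: u, l :: v =>
      z k * harmonicWord u (l :: v) + z l * harmonicWord (k :: u) v + z (k + l) * harmonicWord u v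

/-- The harmonic product `v * w = harmonic v w` on `H1`: the `ℚ`-bilinear extension of the
harmonic product of words. -/
noncomputable def harmonic : H1 →ₗ[ℚ] H1 →ₗ[ℚ] H1 :=
  basis.constr ℚ fun u => basis.constr ℚ fun v => harmonicWord u.toList v.toList

theorem harmonic_word (u v : List ℕ+) : harmonic (word u) (word v) = harmonicWord u v := by
  rw [harmonic, ← basis_apply, ← basis_apply, Module.Basis.constr_basis,
    Module.Basis.constr_basis, FreeMonoid.toList_ofList, FreeMonoid.toList_ofList]

/-- `starWordAux k w` is the value of the star-transformation on the nonempty word `z_k w`: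
`S(z_k) = z_k` and `S(z_k z_l w) = z_k S(z_l w) + S(z_{k+l} w)`. -/
noncomputable def starWordAux : ℕ+ → List ℕ+ → H1
  | k, [] => z k
  | k, l :: w => z k * starWordAux l w + starWordAux (k + l) w

/-- The star-transformation on words. -/
noncomputable def starWord : List ℕ+ → H1
  | [] => 1
  | k :: w => starWordAux k w

/-- The star-transformation `S`, a `ℚ`-linear endomorphism of `H1`. -/
noncomputable def S : H1 →ₗ[ℚ] H1 := basis.constr ℚ fun w => starWord w.toList

theorem S_word (w : List ℕ+) : S (word w) = starWord w := by
  rw [S, ← basis_apply, Module.Basis.constr_basis, FreeMonoid.toList_ofList]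

/-- All shuffles (interleavings) of two sequences, listed with multiplicity: one entry for each
choice of the positions that the first sequence occupies. -/
def shuffles : List ℕ+ → List ℕ+ → List (List ℕ+)
  | [], v => [v]
  | k :: u, [] => [k :: u]
  | k :: u, l :: v =>
      (shuffles u (l :: v)).map (k :: ·) ++ (shuffles (k :: u) v).map (l :: ·)

/-- If the two sequences have no common entry, their shuffles are pairwise distinct, so that the
list `shuffles u v` is just the set of shuffles. -/
theorem nodup_shuffles : ∀ u v : List ℕ+, List.Disjoint u v → (shuffles u v).Nodup
  | [], v, _ => by simp [shuffles]
  | k :: u, [], _ => by simp [shuffles]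
  | k :: u, l :: v, h => by
      have h1 := nodup_shuffles u (l :: v) (List.disjoint_of_disjoint_cons_left h)
      have h2 := nodup_shuffles (k :: u) v (List.disjoint_of_disjoint_cons_right h)
      have hkl : k ≠ l := fun e => h (a := k) (by simp) (by simp [e])
      rw [shuffles, List.nodup_append]
      refine ⟨h1.map fun _ _ e => by simpa using e, h2.map fun _ _ e => by simpa using e, ?_⟩
      intro x hx y hy e
      simp only [List.mem_map] at hx hy
      obtain ⟨x', -, rfl⟩ := hx
      obtain ⟨y', -, rfl⟩ := hy
      exact hkl (List.cons.inj e).1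

/-- The sequence `{a,b}^p = (a,b,a,b,…,a,b)` of length `2p`. -/
def repeatPair (a b : ℕ+) (p : ℕ) : List ℕ+ := (List.replicate p [a, b]).flatten

/-- The indices `I_{p,q}`: all shuffles of `({a,b}^p)` and `({c}^q)`. -/
def indexI (a b c : ℕ+) (p q : ℕ) : List (List ℕ+) :=
  shuffles (repeatPair a b p) (List.replicate q c)

/-- The indices `J_{p,q}`: all shuffles of `(b,{a,b}^p)` and `({c}^q)`. -/
def indexJ (a b c : ℕ+) (p q : ℕ) : List (List ℕ+) :=
  shuffles (b :: repeatPair a b p) (List.replicate q c)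

/-- `𝔰_{p,q}`, the sum of the words indexed by `I_{p,q}`. -/
noncomputable def frs (a b c : ℕ+) (p q : ℕ) : H1 := ((indexI a b c p q).map word).sum

/-- `𝔱_{p,q}`, the sum of the words indexed by `J_{p,q}`. -/
noncomputable def frt (a b c : ℕ+) (p q : ℕ) : H1 := ((indexJ a b c p q).map word).sum

/-- The finite set of all `(i, k, u, j, l, v)` with `2i + k + u = 2p` and `j + l + v = q`
(see `mem_summationSet`; the ranges only bound the search). -/
def summationSet (p q : ℕ) : Finset (ℕ × ℕ × ℕ × ℕ × ℕ × ℕ) :=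
  {x ∈ range (p + 1) ×ˢ range (2 * p + 1) ×ˢ range (2 * p + 1) ×ˢ
      range (q + 1) ×ˢ range (q + 1) ×ˢ range (q + 1) |
    2 * x.1 + x.2.1 + x.2.2.1 = 2 * p ∧ x.2.2.2.1 + x.2.2.2.2.1 + x.2.2.2.2.2 = q}

theorem mem_summationSet (p q i k u j l v : ℕ) :
    (i, k, u, j, l, v) ∈ summationSet p q ↔ 2 * i + k + u = 2 * p ∧ j + l + v = q := by
  simp only [summationSet, mem_filter, mem_product, mem_range]
  omega

end HarmonicAlgebra

open HarmonicAlgebra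

/-! Evaluate words as truncated quasisymmetric sums over finite rational sequences `L`. The harmonic
product becomes ordinary multiplication (`eval_harmonic`), `S` turns strict sums into weak ones, and
the evaluations jointly separate `H1` (`eval_injective`). It remains to compare two-variable
generating series, by induction on `L`.

Let a new head `t` give `α = t^a`, `β = t^b`, `γ = t^c`. The plain pair (𝔰, 𝔱) at `y ↦ -y` is
multiplied by the matrix with rows `(1 - γy, αx²)` and `(β, 1 - γy)`. The starred pair is multiplied
by the inverse of the matrix with rows `(1 - γy, -αx²)` and `(-β, 1 - γy)`, whose adjugate is the
former matrix. Since `αβ = γ²`, its determinant is `(1 - γ(y + x))(1 - γ(y - x))`, and the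
reciprocals of these factors are the growth factors of the two series in `z_c^n`. -/

namespace HarmonicAlgebra

open PowerSeries

/-! ### Evaluation of words as truncated quasisymmetric functions -/

/-- The monomial quasisymmetric function attached to a word, evaluated at a finite sequence of
rationals (the first letter of the word goes with the entries closest to the head). -/
def quasiMonomial : List ℚ → List ℕ+ → ℚ
  | _, [] => 1
  | [], _ :: _ => 0
  | t :: L, k :: u => quasiMonomial L (k :: u) + t ^ (k : ℕ) * quasiMonomial L u

theorem quasiMonomial_nil (L : List ℚ) : quasiMonomial L [] = 1 := by
  cases L <;> rfl

/-- The `ℚ`-linear extension of `quasiMonomial`. -/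
noncomputable def eval (L : List ℚ) : H1 →ₗ[ℚ] ℚ :=
  basis.constr ℚ fun w => quasiMonomial L w.toList

theorem eval_word (L : List ℚ) (w : List ℕ+) : eval L (word w) = quasiMonomial L w := by
  rw [eval, ← basis_apply, Module.Basis.constr_basis, FreeMonoid.toList_ofList]

theorem word_nil : word [] = 1 := by simp [word]

theorem word_cons (k : ℕ+) (w : List ℕ+) : word (k :: w) = z k * word w := by simp [word]

/-- Linear maps on `H1` that agree on words are equal. -/
theorem hom_ext {M : Type*} [AddCommMonoid M] [Module ℚ M] {f g : H1 →ₗ[ℚ] M}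
    (h : ∀ w, f (word w) = g (word w)) : f = g :=
  basis.ext fun w => by
    have := h w.toList
    rwa [← basis_apply, FreeMonoid.ofList_toList] at this

theorem eval_one (L : List ℚ) : eval L 1 = 1 := by
  rw [← word_nil, eval_word, quasiMonomial_nil]

theorem eval_nil_z_mul (k : ℕ+) (w : H1) : eval [] (z k * w) = 0 := by
  have : eval [] ∘ₗ LinearMap.mulLeft ℚ (z k) = 0 := hom_ext fun u => by
    simp [← word_cons, eval_word, quasiMonomial]
  exact LinearMap.congr_fun this w

theorem eval_cons_z_mul (t : ℚ) (L : List ℚ) (k : ℕ+) (w : H1) :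
    eval (t :: L) (z k * w) = eval L (z k * w) + t ^ (k : ℕ) * eval L w := by
  have : eval (t :: L) ∘ₗ LinearMap.mulLeft ℚ (z k) =
      eval L ∘ₗ LinearMap.mulLeft ℚ (z k) + t ^ (k : ℕ) • eval L := hom_ext fun u => by
    simp [← word_cons, eval_word, quasiMonomial]
  exact LinearMap.congr_fun this w

/-- In a product of two sums the head `t` is used by the first word only, the second only, both, or
neither; the case of both produces `z (k + l)`. -/
theorem eval_harmonicWord (L : List ℚ) (u v : List ℕ+) :
    eval L (harmonicWord u v) = quasiMonomial L u * quasiMonomial L v := by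
  induction L generalizing u v with
  | nil =>
    rcases u with _ | ⟨k, u⟩
    · simp [harmonicWord, eval_word, quasiMonomial]
    rcases v with _ | ⟨l, v⟩
    · simp [harmonicWord, eval_word, quasiMonomial]
    · simp [harmonicWord, eval_nil_z_mul, quasiMonomial]
  | cons t L ih =>
    rcases u with _ | ⟨k, u⟩
    · simp [harmonicWord, eval_word, quasiMonomial]
    rcases v with _ | ⟨l, v⟩
    · simp [harmonicWord, eval_word, quasiMonomial]
    -- This accounts for the terms in which `t` is not used.
    · have h := ih (k :: u) (l :: v)
      simp only [harmonicWord, map_add] at h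
      simp only [harmonicWord, map_add, eval_cons_z_mul, quasiMonomial, ih, PNat.add_coe, pow_add]
      linear_combination h

theorem eval_harmonic (L : List ℚ) (v w : H1) :
    eval L (harmonic v w) = eval L v * eval L w := by
  have : harmonic.compr₂ (eval L) = (LinearMap.mul ℚ ℚ).compl₁₂ (eval L) (eval L) :=
    hom_ext fun u => hom_ext fun w => by
      simp [harmonic_word, eval_harmonicWord, eval_word]
  exact LinearMap.congr_fun₂ this v w

/-! ### Evaluation of the star-transformation -/

theorem S_one : S 1 = 1 := by rw [← word_nil, S_word, starWord, word_nil]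

theorem eval_nil_starWordAux (k : ℕ+) (w : List ℕ+) : eval [] (starWordAux k w) = 0 := by
  induction w generalizing k with
  | nil => simpa [starWordAux] using eval_nil_z_mul k 1
  | cons l w ih => simp [starWordAux, eval_nil_z_mul, ih]

/-- The last factor keeps `t :: L` rather than `L`: in a weak sum the entry `t` may be used again by
the next letter. -/
theorem eval_cons_starWordAux (t : ℚ) (L : List ℚ) (k : ℕ+) (w : List ℕ+) :
    eval (t :: L) (starWordAux k w) =
      eval L (starWordAux k w) + t ^ (k : ℕ) * eval (t :: L) (starWord w) := by
  induction w generalizing k with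
  | nil => simpa [starWordAux, starWord, eval_one] using eval_cons_z_mul t L k 1
  | cons l w ih =>
    have h := ih l
    simp only [starWordAux, starWord, map_add, eval_cons_z_mul, ih, PNat.add_coe, pow_add]
    ring

theorem eval_nil_S_z_mul (k : ℕ+) (w : H1) : eval [] (S (z k * w)) = 0 := by
  have : eval [] ∘ₗ S ∘ₗ LinearMap.mulLeft ℚ (z k) = 0 := hom_ext fun u => by
    simp [← word_cons, S_word, starWord, eval_nil_starWordAux]
  exact LinearMap.congr_fun this w

theorem eval_cons_S_z_mul (t : ℚ) (L : List ℚ) (k : ℕ+) (w : H1) :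
    eval (t :: L) (S (z k * w)) =
      eval L (S (z k * w)) + t ^ (k : ℕ) * eval (t :: L) (S w) := by
  have : eval (t :: L) ∘ₗ S ∘ₗ LinearMap.mulLeft ℚ (z k) =
      eval L ∘ₗ S ∘ₗ LinearMap.mulLeft ℚ (z k) + t ^ (k : ℕ) • (eval (t :: L) ∘ₗ S) :=
    hom_ext fun u => by
      simp only [LinearMap.comp_apply, LinearMap.mulLeft_apply, LinearMap.add_apply,
        LinearMap.smul_apply, ← word_cons, S_word, starWord, eval_cons_starWordAux, smul_eq_mul]
  exact LinearMap.congr_fun this w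

/-! ### The evaluations separate the elements of `H1` -/

/-- Removal of the first letter `k`; words not starting with `k` are sent to `0`. -/
noncomputable def removeHead (k : ℕ+) : H1 →ₗ[ℚ] H1 :=
  basis.constr ℚ fun w => match w.toList with
    | [] => 0
    | l :: u => if l = k then word u else 0

/-- The difference `eval (t :: L) w - eval L w`, as a polynomial in `t`. -/
noncomputable def evalIncrement (L : List ℚ) : H1 →ₗ[ℚ] Polynomial ℚ :=
  basis.constr ℚ fun w => match w.toList with
    | [] => 0
    | l :: u => Polynomial.monomial (l : ℕ) (quasiMonomial L u)

theorem removeHead_word_nil (k : ℕ+) : removeHead k (word []) = 0 := by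
  rw [removeHead, ← basis_apply, Module.Basis.constr_basis, FreeMonoid.toList_ofList]

theorem removeHead_word_cons (k l : ℕ+) (u : List ℕ+) :
    removeHead k (word (l :: u)) = if l = k then word u else 0 := by
  rw [removeHead, ← basis_apply, Module.Basis.constr_basis, FreeMonoid.toList_ofList]

theorem evalIncrement_word_nil (L : List ℚ) : evalIncrement L (word []) = 0 := by
  rw [evalIncrement, ← basis_apply, Module.Basis.constr_basis, FreeMonoid.toList_ofList]

theorem evalIncrement_word_cons (L : List ℚ) (l : ℕ+) (u : List ℕ+) :
    evalIncrement L (word (l :: u)) = Polynomial.monomial (l : ℕ) (quasiMonomial L u) := by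
  rw [evalIncrement, ← basis_apply, Module.Basis.constr_basis, FreeMonoid.toList_ofList]

theorem eval_cons (t : ℚ) (L : List ℚ) (w : H1) :
    eval (t :: L) w = eval L w + (evalIncrement L w).eval t := by
  have : eval (t :: L) = eval L + Polynomial.leval t ∘ₗ evalIncrement L := hom_ext fun u => by
    rcases u with _ | ⟨k, u⟩
    · simp [eval_word, quasiMonomial_nil, evalIncrement_word_nil]
    · simp [eval_word, quasiMonomial, evalIncrement_word_cons, mul_comm]
  exact LinearMap.congr_fun this w

theorem coeff_evalIncrement (L : List ℚ) (k : ℕ+) (w : H1) :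
    (evalIncrement L w).coeff k = eval L (removeHead k w) := by
  have : Polynomial.lcoeff ℚ k ∘ₗ evalIncrement L = eval L ∘ₗ removeHead k := hom_ext fun u => by
    rcases u with _ | ⟨l, u⟩
    · simp [removeHead_word_nil, evalIncrement_word_nil]
    · by_cases h : l = k <;>
        simp [evalIncrement_word_cons, removeHead_word_cons, Polynomial.coeff_monomial, h,
          eval_word]
  exact LinearMap.congr_fun this w

theorem repr_word (u v : List ℕ+) :
    basis.repr (word u) (FreeMonoid.ofList v) = if u = v then 1 else 0 := by
  classical
  rw [← basis_apply, Module.Basis.repr_self, Finsupp.single_apply]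
  exact if_congr FreeMonoid.ofList.injective.eq_iff rfl rfl

theorem repr_nil (w : H1) : basis.repr w (FreeMonoid.ofList []) = eval [] w := by
  have : basis.coord (FreeMonoid.ofList []) = eval [] := hom_ext fun u => by
    rw [Module.Basis.coord_apply, repr_word, eval_word]
    cases u <;> simp [quasiMonomial]
  exact LinearMap.congr_fun this w

theorem repr_cons (k : ℕ+) (v : List ℕ+) (w : H1) :
    basis.repr w (FreeMonoid.ofList (k :: v)) =
      basis.repr (removeHead k w) (FreeMonoid.ofList v) := by
  have : basis.coord (FreeMonoid.ofList (k :: v)) =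
      basis.coord (FreeMonoid.ofList v) ∘ₗ removeHead k := hom_ext fun u => by
    rw [LinearMap.comp_apply, Module.Basis.coord_apply, Module.Basis.coord_apply, repr_word]
    rcases u with _ | ⟨l, u⟩
    · simp [removeHead_word_nil]
    · by_cases h : l = k <;> simp [removeHead_word_cons, repr_word, h]
  exact LinearMap.congr_fun this w

/-- Prepending an arbitrary `t` gives a polynomial in `t` with infinitely many zeros, so its
coefficients vanish. These are evaluations of `removeHead k w`, which thus inherits the hypothesis;
stripping letters kills every coordinate. -/
theorem eq_zero_of_eval_eq_zero {w : H1} (h : ∀ L, eval L w = 0) : w = 0 := by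
  have key : ∀ (v : List ℕ+) (w : H1), (∀ L, eval L w = 0) →
      basis.repr w (FreeMonoid.ofList v) = 0 := by
    intro v
    induction v with
    | nil => exact fun w h => (repr_nil w).trans (h [])
    | cons k v ih =>
      refine fun w h => (repr_cons k v w).trans (ih _ fun L => ?_)
      have hz : evalIncrement L w = 0 := Polynomial.funext fun t => by
        simpa [h] using (eval_cons t L w).symm
      rw [← coeff_evalIncrement, hz, Polynomial.coeff_zero]
  apply basis.repr.injective
  ext v
  simpa using key v.toList w h

theorem eval_injective {v w : H1} (h : ∀ L, eval L v = eval L w) : v = w :=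
  sub_eq_zero.1 <| eq_zero_of_eval_eq_zero fun L => by rw [map_sub, h, sub_self]

/-! ### Recursions for `𝔰` and `𝔱` -/

theorem shuffles_nil_right (u : List ℕ+) : shuffles u [] = [u] := by
  cases u <;> simp [shuffles]

theorem sum_map_word_map_cons (k : ℕ+) (l : List (List ℕ+)) :
    ((l.map (k :: ·)).map word).sum = z k * (l.map word).sum := by
  induction l with
  | nil => simp
  | cons w l ih =>
    simp only [List.map_cons, List.sum_cons, mul_add, word_cons] at ih ⊢
    rw [ih]

section Recursions

variable (a b c : ℕ+)

theorem repeatPair_succ (p : ℕ) : repeatPair a b (p + 1) = a :: b :: repeatPair a b p := by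
  simp [repeatPair, List.replicate_succ]

theorem frs_zero_zero : frs a b c 0 0 = 1 := by
  simp [frs, indexI, repeatPair, shuffles, word_nil]

theorem frs_zero_succ (q : ℕ) : frs a b c 0 (q + 1) = z c * frs a b c 0 q := by
  simp [frs, indexI, repeatPair, shuffles, List.replicate_succ, word_cons]

theorem frs_succ_zero (p : ℕ) : frs a b c (p + 1) 0 = z a * frt a b c p 0 := by
  simp [frs, frt, indexI, indexJ, repeatPair_succ, shuffles, word_cons]

/-- Sort the shuffles by first letter. Removing `a` leaves a sequence starting with `b`, which is
why 𝔰 and 𝔱 must be treated together. -/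
theorem frs_succ_succ (p q : ℕ) :
    frs a b c (p + 1) (q + 1) = z a * frt a b c p (q + 1) + z c * frs a b c (p + 1) q := by
  simp only [frs, frt, indexI, indexJ, repeatPair_succ, List.replicate_succ]
  rw [shuffles, List.map_append, List.sum_append, sum_map_word_map_cons, sum_map_word_map_cons]

theorem frt_zero (p : ℕ) : frt a b c p 0 = z b * frs a b c p 0 := by
  simp [frs, frt, indexI, indexJ, shuffles_nil_right, word_cons]

theorem frt_succ (p q : ℕ) :
    frt a b c p (q + 1) = z b * frs a b c p (q + 1) + z c * frt a b c p q := by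
  simp only [frs, frt, indexI, indexJ, shuffles, List.replicate_succ,
    List.map_append, List.sum_append, sum_map_word_map_cons]

end Recursions

/-! ### Generating series -/

/-- The double series `∑ f m n x ^ m y ^ n`, where `x` is the inner and `y` the outer variable. -/
noncomputable def doubleSeries (f : ℕ → ℕ → ℚ) : ℚ⟦X⟧⟦X⟧ :=
  PowerSeries.mk fun n => PowerSeries.mk fun m => f m n

/-- The double series `∑ f m n x ^ (2 m) y ^ n`. -/
noncomputable def evenSeries (f : ℕ → ℕ → ℚ) : ℚ⟦X⟧⟦X⟧ :=
  doubleSeries fun m n => if Even m then f (m / 2) n else 0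

theorem coeff_doubleSeries (f : ℕ → ℕ → ℚ) (m n : ℕ) :
    coeff m (coeff n (doubleSeries f)) = f m n := by
  simp [doubleSeries]

theorem coeff_evenSeries (f : ℕ → ℕ → ℚ) (m n : ℕ) :
    coeff (2 * m) (coeff n (evenSeries f)) = f m n := by
  simp [evenSeries, coeff_doubleSeries]

theorem coeff_evenSeries_of_odd (f : ℕ → ℕ → ℚ) {m : ℕ} (hm : ¬ Even m) (n : ℕ) :
    coeff m (coeff n (evenSeries f)) = 0 := by
  simp [evenSeries, coeff_doubleSeries, hm]

/-- The inner variable. -/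
noncomputable def xvar : ℚ⟦X⟧⟦X⟧ := C X

/-- The outer variable. -/
noncomputable def yvar : ℚ⟦X⟧⟦X⟧ := X

/-- A rational constant as a double series. -/
noncomputable def const : ℚ →+* ℚ⟦X⟧⟦X⟧ := (C (R := ℚ⟦X⟧)).comp (C (R := ℚ))

theorem const_mul_doubleSeries (r : ℚ) (f : ℕ → ℕ → ℚ) :
    const r * doubleSeries f = doubleSeries fun m n => r * f m n := by
  ext n m
  simp [const, doubleSeries]

theorem doubleSeries_add (f g : ℕ → ℕ → ℚ) :
    doubleSeries f + doubleSeries g = doubleSeries fun m n => f m n + g m n := by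
  ext n m
  simp [doubleSeries]

theorem yvar_mul_doubleSeries (f : ℕ → ℕ → ℚ) :
    yvar * doubleSeries f =
      doubleSeries fun m n => match n with
        | 0 => 0
        | n + 1 => f m n := by
  ext n m
  cases n <;> simp [yvar, doubleSeries, coeff_succ_X_mul]

theorem xvar_mul_doubleSeries (f : ℕ → ℕ → ℚ) :
    xvar * doubleSeries f =
      doubleSeries fun m n => match m with
        | 0 => 0
        | m + 1 => f m n := by
  ext n m
  cases m <;> simp [xvar, doubleSeries, coeff_succ_X_mul]

theorem const_eq_doubleSeries (r : ℚ) :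
    const r = doubleSeries fun m n => if m = 0 ∧ n = 0 then r else 0 := by
  ext n m
  by_cases hn : n = 0 <;> simp [const, doubleSeries, coeff_C, hn]

theorem const_mul_evenSeries (r : ℚ) (f : ℕ → ℕ → ℚ) :
    const r * evenSeries f = evenSeries fun m n => r * f m n := by
  simp [evenSeries, const_mul_doubleSeries]

theorem evenSeries_add (f g : ℕ → ℕ → ℚ) :
    evenSeries f + evenSeries g = evenSeries fun m n => f m n + g m n := by
  simp only [evenSeries, doubleSeries_add]
  congr! 3
  split_ifs <;> simp

theorem yvar_mul_evenSeries (f : ℕ → ℕ → ℚ) :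
    yvar * evenSeries f =
      evenSeries fun m n => match n with
        | 0 => 0
        | n + 1 => f m n := by
  simp only [evenSeries, yvar_mul_doubleSeries]
  congr! 3 with m n
  cases n <;> simp

theorem xvar_sq_mul_evenSeries (f : ℕ → ℕ → ℚ) :
    xvar ^ 2 * evenSeries f =
      evenSeries fun m n => match m with
        | 0 => 0
        | m + 1 => f m n := by
  simp only [evenSeries, sq, mul_assoc, xvar_mul_doubleSeries]
  congr! 3 with m n
  rcases m with _ | _ | m
  · simp
  · simp
  · have : (m + 1 + 1) / 2 = m / 2 + 1 := by omega
    simp [Nat.even_add, this]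

theorem const_eq_evenSeries (r : ℚ) :
    const r = evenSeries fun m n => if m = 0 ∧ n = 0 then r else 0 := by
  rw [const_eq_doubleSeries, evenSeries]
  congr! 3 with m n
  rcases m with _ | _ | m <;> simp

theorem coeff_coeff_evenSeries_mul (f g h : ℕ → ℕ → ℚ) (p q : ℕ) :
    coeff (2 * p) (coeff q (evenSeries f * doubleSeries g * doubleSeries h)) =
      ∑ x ∈ summationSet p q,
        f x.1 x.2.2.2.1 * g x.2.1 x.2.2.2.2.1 * h x.2.2.1 x.2.2.2.2.2 := by
  simp only [coeff_mul, map_sum, Finset.sum_mul, coeff_doubleSeries]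
  simp only [Finset.sum_sigma']
  symm
  -- The nested antidiagonals record the splittings of the two exponents. The indices missed have an
  -- odd exponent in the even series, hence contribute zero.
  refine Finset.sum_of_injOn
    (fun x => ⟨(x.2.2.2.1 + x.2.2.2.2.1, x.2.2.2.2.2), ⟨(x.2.2.2.1, x.2.2.2.2.1),
      ⟨(2 * x.1 + x.2.1, x.2.2.1), (2 * x.1, x.2.1)⟩⟩⟩) ?_ ?_ ?_ ?_
  · rintro ⟨i, k, u, j, l, v⟩ _ ⟨i', k', u', j', l', v'⟩ _ e
    simp at e
    simp
    omega
  · rintro ⟨i, k, u, j, l, v⟩ hx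
    simp [mem_summationSet] at hx
    simp
    omega
  · rintro ⟨⟨r, v⟩, ⟨j, l⟩, ⟨m, u⟩, ⟨n, k⟩⟩ hx hn
    simp at hx
    by_cases he : Even n
    · obtain ⟨i, rfl⟩ := he
      refine absurd ⟨(i, k, u, j, l, v), ?_, ?_⟩ hn
      · simp [mem_summationSet]
        omega
      · obtain ⟨h1, h2, h3, h4⟩ := hx
        simp [two_mul, h2, h4]
    · simp [coeff_evenSeries_of_odd _ he]
  · rintro ⟨i, k, u, j, l, v⟩ _
    simp [coeff_evenSeries]

/-! ### Effect of a new entry on the generating series -/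

section Series

variable (a b c : ℕ+) (ε : ℚ)

/-- The generating series `∑ e(𝔰_{p,q}) x ^ (2 p) (ε y) ^ q`. -/
noncomputable def seriesS (e : H1 →ₗ[ℚ] ℚ) : ℚ⟦X⟧⟦X⟧ :=
  evenSeries fun p q => ε ^ q * e (frs a b c p q)

/-- The generating series `∑ e(𝔱_{p,q}) x ^ (2 p) (ε y) ^ q`. -/
noncomputable def seriesT (e : H1 →ₗ[ℚ] ℚ) : ℚ⟦X⟧⟦X⟧ :=
  evenSeries fun p q => ε ^ q * e (frt a b c p q)

/-- The generating series `∑ e(z_c ^ n) (y + ε x) ^ n`. -/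
noncomputable def seriesG (e : H1 →ₗ[ℚ] ℚ) : ℚ⟦X⟧⟦X⟧ :=
  doubleSeries fun k l => ε ^ k * ((k + l).choose k : ℚ) * e (z c ^ (k + l))

variable {ε} {e e' d : H1 →ₗ[ℚ] ℚ} {t : ℚ}

/-- The separate functional `d` covers both cases: `d = e` for plain evaluations, `d = e'` for
starred ones. -/
theorem seriesS_eq_add (h1 : e' 1 = e 1)
    (h : ∀ k w, e' (z k * w) = e (z k * w) + t ^ (k : ℕ) * d w) :
    seriesS a b c ε e' = seriesS a b c ε e +
      const ε * (const (t ^ (c : ℕ)) * (yvar * seriesS a b c ε d)) +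
      const (t ^ (a : ℕ)) * (xvar ^ 2 * seriesT a b c ε d) := by
  simp only [seriesS, seriesT, const_mul_evenSeries, yvar_mul_evenSeries, xvar_sq_mul_evenSeries,
    evenSeries_add]
  congr! 3 with p q
  rcases p with _ | p <;> rcases q with _ | q <;>
    simp only [frs_zero_zero, frs_zero_succ, frs_succ_zero, frs_succ_succ, h, h1, map_add] <;> ring

theorem seriesT_eq_add
    (h : ∀ k w, e' (z k * w) = e (z k * w) + t ^ (k : ℕ) * d w) :
    seriesT a b c ε e' = seriesT a b c ε e +
      const ε * (const (t ^ (c : ℕ)) * (yvar * seriesT a b c ε d)) +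
      const (t ^ (b : ℕ)) * seriesS a b c ε d := by
  simp only [seriesS, seriesT, const_mul_evenSeries, yvar_mul_evenSeries, evenSeries_add]
  congr! 3 with p q
  rcases q with _ | q <;> simp only [frt_zero, frt_succ, h, map_add] <;> ring

theorem seriesG_eq_add (h1 : e' 1 = e 1)
    (h : ∀ k w, e' (z k * w) = e (z k * w) + t ^ (k : ℕ) * d w) :
    seriesG c ε e' = seriesG c ε e + const (t ^ (c : ℕ)) * (yvar * seriesG c ε d) +
      const ε * (const (t ^ (c : ℕ)) * (xvar * seriesG c ε d)) := by
  have hp : ∀ n, e' (z c ^ (n + 1)) = e (z c ^ (n + 1)) + t ^ (c : ℕ) * d (z c ^ n) := fun n => by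
    rw [pow_succ', h]
  simp only [seriesG, const_mul_doubleSeries, yvar_mul_doubleSeries, xvar_mul_doubleSeries,
    doubleSeries_add]
  congr! 3 with k l
  rcases k with _ | k <;> rcases l with _ | l
  · simp [h1]
  · simp [hp]
  · simp [hp, pow_succ ε]
    ring
  -- Pascal's rule splits off one factor `y + εx`.
  · have e1 : k + 1 + (l + 1) = k + l + 1 + 1 := by omega
    have e2 : k + 1 + l = k + l + 1 := by omega
    have e3 : k + (l + 1) = k + l + 1 := by omega
    simp only [e1, e2, e3, hp, Nat.choose_succ_succ (k + l + 1) k, Nat.cast_add]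
    ring

theorem seriesS_of_nil (h1 : e 1 = 1) (h : ∀ k w, e (z k * w) = 0) : seriesS a b c ε e = 1 := by
  rw [← map_one const, const_eq_evenSeries, seriesS]
  congr! 3 with p q
  rcases p with _ | p <;> rcases q with _ | q <;>
    simp [frs_zero_zero, frs_zero_succ, frs_succ_zero, frs_succ_succ, h, h1]

theorem seriesT_of_nil (h : ∀ k w, e (z k * w) = 0) : seriesT a b c ε e = 0 := by
  rw [← map_zero const, const_eq_evenSeries, seriesT]
  congr! 3 with p q
  rcases q with _ | q <;> simp [frt_zero, frt_succ, h]

theorem seriesG_of_nil (h1 : e 1 = 1) (h : ∀ k w, e (z k * w) = 0) : seriesG c ε e = 1 := by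
  rw [← map_one const, const_eq_doubleSeries, seriesG]
  congr! 3 with k l
  rcases k with _ | k <;> rcases l with _ | l <;> simp [h1, h, pow_succ', ← add_assoc]

end Series

/-- The constant term is 1. This permits cancelling the determinant. -/
theorem one_sub_yvar_sq_sub_xvar_sq_ne_zero (s : ℚ) :
    (1 - const s * yvar) ^ 2 - const s ^ 2 * xvar ^ 2 ≠ 0 := fun h => by
  have := congrArg ((constantCoeff (R := ℚ)).comp (constantCoeff (R := ℚ⟦X⟧))) h
  simp [xvar, yvar] at this

/-- The generating series form of the theorem, after evaluation at a finite sequence. -/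
theorem seriesS_star_and_seriesT_star (a b c : ℕ+) (habc : a + b = 2 * c) (L : List ℚ) :
    seriesS a b c 1 (eval L ∘ₗ S) =
        seriesS a b c (-1) (eval L) * seriesG c (-1) (eval L ∘ₗ S) * seriesG c 1 (eval L ∘ₗ S) ∧
      seriesT a b c 1 (eval L ∘ₗ S) =
        seriesT a b c (-1) (eval L) * seriesG c (-1) (eval L ∘ₗ S) *
          seriesG c 1 (eval L ∘ₗ S) := by
  induction L with
  | nil =>
    have h1 : (eval [] ∘ₗ S) 1 = 1 := by simp [S_one, eval_one]
    have h : ∀ k w, (eval [] ∘ₗ S) (z k * w) = 0 := eval_nil_S_z_mul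
    simp [seriesS_of_nil a b c h1 h, seriesT_of_nil a b c h, seriesG_of_nil c h1 h,
      seriesS_of_nil a b c (eval_one []) eval_nil_z_mul, seriesT_of_nil a b c eval_nil_z_mul]
  | cons t L ih =>
    obtain ⟨ihS, ihT⟩ := ih
    have h1 : (eval (t :: L) ∘ₗ S) 1 = (eval L ∘ₗ S) 1 := by simp [S_one, eval_one]
    have h : ∀ k w, (eval (t :: L) ∘ₗ S) (z k * w) =
        (eval L ∘ₗ S) (z k * w) + t ^ (k : ℕ) * (eval (t :: L) ∘ₗ S) w := eval_cons_S_z_mul t L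
    have g1 : eval (t :: L) 1 = eval L 1 := by simp [eval_one]
    have g := eval_cons_z_mul t L
    have hS := seriesS_eq_add a b c (ε := 1) h1 h
    have hT := seriesT_eq_add a b c (ε := 1) h
    have hG := seriesG_eq_add c (ε := 1) h1 h
    have hG' := seriesG_eq_add c (ε := -1) h1 h
    rw [seriesS_eq_add a b c g1 g, seriesT_eq_add a b c g]
    -- The condition `a + b = 2c` enters here, making the determinant factor.
    have hab : const (t ^ (a : ℕ)) * const (t ^ (b : ℕ)) = const (t ^ (c : ℕ)) ^ 2 := by
      have : (a : ℕ) + b = 2 * c := by exact_mod_cast congrArg PNat.val habc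
      rw [← map_mul, ← map_pow, ← pow_add, this, ← pow_mul, mul_comm]
    have hD := one_sub_yvar_sq_sub_xvar_sq_ne_zero (t ^ (c : ℕ))
    rw [map_one, one_mul] at hS hT hG
    rw [map_neg, map_one] at hG' ⊢
    rw [ihS] at hS
    rw [ihT] at hT
    generalize seriesS a b c 1 (eval (t :: L) ∘ₗ S) = s' at *
    generalize seriesT a b c 1 (eval (t :: L) ∘ₗ S) = r' at *
    generalize seriesG c 1 (eval (t :: L) ∘ₗ S) = G' at *
    generalize seriesG c (-1) (eval (t :: L) ∘ₗ S) = H' at *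
    generalize seriesG c 1 (eval L ∘ₗ S) = G at *
    generalize seriesG c (-1) (eval L ∘ₗ S) = H at *
    generalize seriesS a b c (-1) (eval L) = s at *
    generalize seriesT a b c (-1) (eval L) = r at *
    generalize const (t ^ (a : ℕ)) = α at *
    generalize const (t ^ (b : ℕ)) = β at *
    generalize const (t ^ (c : ℕ)) = γ at *
    generalize xvar = x at *
    generalize yvar = y at *
    -- Expressing the old series through the new ones avoids inverses.
    have hGe : G = (1 - γ * y - γ * x) * G' := by linear_combination -hG
    have hHe : H = (1 - γ * y + γ * x) * H' := by linear_combination -hG'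
    subst hGe hHe
    constructor
    -- Cramer's rule: the multipliers of `hS` and `hT` form the first row of the adjugate.
    · apply mul_left_cancel₀ hD
      linear_combination (1 - γ * y) * hS + α * x ^ 2 * hT + x ^ 2 * s' * hab
    · apply mul_left_cancel₀ hD
      linear_combination (1 - γ * y) * hT + β * hS + x ^ 2 * r' * hab

/-- The sign `(-1)^j` comes from the first series, `(-1)^k` from the series in `y - x`. -/
theorem eval_mul_eq_sum (L : List ℚ) (c : ℕ+) (p q : ℕ) (f : ℕ → ℕ → H1) :
    coeff (2 * p) (coeff q ((evenSeries fun i j => (-1) ^ j * eval L (f i j)) *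
        seriesG c (-1) (eval L ∘ₗ S) * seriesG c 1 (eval L ∘ₗ S))) =
      eval L (∑ x ∈ summationSet p q,
        ((-1 : ℚ) ^ (x.2.2.2.1 + x.2.1) * ((x.2.1 + x.2.2.2.2.1).choose x.2.1 : ℚ) *
            ((x.2.2.1 + x.2.2.2.2.2).choose x.2.2.1 : ℚ)) •
          harmonic (harmonic (f x.1 x.2.2.2.1) (S (z c ^ (x.2.1 + x.2.2.2.2.1))))
            (S (z c ^ (x.2.2.1 + x.2.2.2.2.2)))) := by
  rw [seriesG, seriesG, coeff_coeff_evenSeries_mul, map_sum]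
  refine Finset.sum_congr rfl fun x _ => ?_
  simp only [map_smul, smul_eq_mul, eval_harmonic, LinearMap.comp_apply, one_pow, pow_add]
  ring

end HarmonicAlgebra

open HarmonicAlgebra
theorem mainTheorem5 (a b c : ℕ+) (habc : a + b = 2 * c) (p q : ℕ) :
    S (frs a b c p q) =
      ∑ ⟨i, k, u, j, l, v⟩ ∈ summationSet p q,
        ((-1 : ℚ) ^ (j + k) * ((k + l).choose k : ℚ) * ((u + v).choose u : ℚ)) •
          harmonic (harmonic (frs a b c i j) (S (z c ^ (k + l)))) (S (z c ^ (u + v))) ∧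
    S (frt a b c p q) =
      ∑ ⟨i, k, u, j, l, v⟩ ∈ summationSet p q,
        ((-1 : ℚ) ^ (j + k) * ((k + l).choose k : ℚ) * ((u + v).choose u : ℚ)) •
          harmonic (harmonic (frt a b c i j) (S (z c ^ (k + l)))) (S (z c ^ (u + v))) := by
  constructor
  · refine eval_injective fun L => ?_
    refine Eq.trans ?_ (eval_mul_eq_sum L c p q (frs a b c))
    rw [← seriesS, ← (seriesS_star_and_seriesT_star a b c habc L).1, seriesS, coeff_evenSeries]
    simp
  · refine eval_injective fun L => ?_
    refine Eq.trans ?_ (eval_mul_eq_sum L c p q (frt a b c))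
    rw [← seriesT, ← (seriesS_star_and_seriesT_star a b c habc L).2, seriesT, coeff_evenSeries]
    simp
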